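/- For $t>0$ and $f:\mathbb{Z}^d\to\mathbb{C}$ let $$\mathcal{M}_t^{B^1} f(x)=\frac{1}{|(t\cdot B^1)\cap\mathbb{Z}^d|}\sum_{y\in (t\cdot B^1)\cap\mathbb{Z}^d} f(x-y),\qquad x\in\mathbb{Z}^d,$$ where $B^1=\{x\in\mathbb{R}^d:\sum_{i=1}^d|x_i|\le 1\}$ and $t\cdot B^1=\{tx : x\in B^1\}$, and let $\mathbb{D}=\{2^n:n=0,1,2,\dots\}$. Then for every real $p\in[2,\infty)$, every integer $d\ge 4$ and every $f\in l^p(\mathbb{Z}^d)$, the function $x\mapsto\sup_{t\in\mathbb{D},\,t\le\sqrt d}|\mathcal{M}_t^{B^1}f(x)|$ belongs to $l^p(\mathbb{Z}^d)$ and $$\Big\|\sup_{t\in\mathbb{D},\ t\le\sqrt d}|\mathcal{M}_t^{B^1}f|\Big\|_{l^p(\mathbb{Z}^d)}\le 30^{4/p}\,\|f\|_{l^p(\mathbb{Z}^d)}.$$ -/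

import Mathlib

open scoped ENNReal Pointwise

noncomputable section

/-- The closed unit ball of the `l¹` norm in `ℝ^d`. -/
def l1UnitBall (d : ℕ) : Set (Fin d → ℝ) :=
  {x | ∑ i, |x i| ≤ 1}

/-- The set `(t · B¹) ∩ ℤ^d`, as a set of integer vectors. -/
def dilateLatticePoints (d : ℕ) (t : ℝ) : Set (Fin d → ℤ) :=
  {y | (fun i => (y i : ℝ)) ∈ t • l1UnitBall d}

theorem dilateLatticePoints_finite (d : ℕ) (t : ℝ) : (dilateLatticePoints d t).Finite := by
  refine (Set.finite_Icc (fun _ : Fin d => -⌈|t|⌉) (fun _ => ⌈|t|⌉)).subset ?_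
  rintro y ⟨x, hx, hxy⟩
  have key : ∀ i, |y i| ≤ ⌈|t|⌉ := by
    intro i
    have h1 : (y i : ℝ) = t * x i := (congrFun hxy i).symm
    have h2 : |x i| ≤ 1 :=
      (Finset.single_le_sum (f := fun i => |x i|) (fun j _ => abs_nonneg (x j))
        (Finset.mem_univ i)).trans hx
    have h3 : |(y i : ℝ)| ≤ |t| := by
      rw [h1, abs_mul]
      exact mul_le_of_le_one_right (abs_nonneg t) h2
    exact_mod_cast h3.trans (Int.le_ceil |t|)
  exact ⟨fun i => (abs_le.mp (key i)).1, fun i => (abs_le.mp (key i)).2⟩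

/-- The finite set `(t · B¹) ∩ ℤ^d`. -/
def l1BallPoints (d : ℕ) (t : ℝ) : Finset (Fin d → ℤ) :=
  (dilateLatticePoints_finite d t).toFinset

/-- The discrete Hardy-Littlewood averaging operator `𝓜_t` over `(t · B¹) ∩ ℤ^d`. -/
def l1Average (d : ℕ) (t : ℝ) (f : (Fin d → ℤ) → ℂ) (x : Fin d → ℤ) : ℂ :=
  ((l1BallPoints d t).card : ℂ)⁻¹ * ∑ y ∈ l1BallPoints d t, f (x - y)

/-- The dyadic integers `2^n`, `n = 0, 1, 2, …`, as real numbers. -/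
def dyadicIntegers : Set ℝ :=
  {t | ∃ n : ℕ, t = 2 ^ n}

/-- The maximal function `sup |𝓜_t f|` over dyadic `t ≤ √d`. For `d ≥ 1` this is the supremum
of a finite non-empty family. -/
def smallDyadicMaximal (d : ℕ) (f : (Fin d → ℤ) → ℂ) (x : Fin d → ℤ) : ℝ :=
  ⨆ t : {t : ℝ // t ∈ dyadicIntegers ∧ t ≤ √(d : ℝ)}, ‖l1Average d t f x‖

end

/-!
All averages over balls of radius at most `√d` are dominated by the powers of one operator: the
random walk on `ℤ^d` with steps `± k e_i`, where `k` is geometrically distributed with ratio `a` of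
size `1 / √d`. The walk reaches a point `y` with `j` non-zero coordinates in `j` steps by making
them right in any of the `j !` orders, so the `j`-step kernel at `y` is at least
`j ! * ((1 - a) / (2 * d)) ^ j * a ^ (‖y‖₁ - j)`. Counting the points with entries in `{-1, 0, 1}`
shows that the reciprocal of the number of lattice points of the ball of radius `N ≤ √d` is at most
`6 * (3 / 4) ^ (N - j)` times this, and summing the geometric series over `j` gives the domination.
The walk is a symmetric positivity-preserving contraction of `ℓ²`, so Stein's maximal theorem
bounds the supremum of its powers there without any dependence on `d`. For `p > 2`, Jensen's
inequality reduces the bound for `f` in `ℓᵖ` to the one for `|f| ^ (p / 2)` in `ℓ²`.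
-/

section Stein

open Finset
open scoped lp InnerProductSpace

theorem le_of_sq_le_mul {R : Type*} [CommRing R] [LinearOrder R] [IsStrictOrderedRing R] {a b : R}
    (hb : 0 ≤ b) (h : a ^ 2 ≤ b * a) : a ≤ b := by
  by_contra! hlt
  nlinarith

variable {E : Type*} [NormedAddCommGroup E] [InnerProductSpace ℝ E] {T : E →ₗ[ℝ] E}

theorem pow_two_mul_succ_apply (T : E →ₗ[ℝ] E) (k : ℕ) (x : E) :
    (T ^ (2 * (k + 1))) x = T ((T ^ (2 * k)) (T x)) := by
  rw [show 2 * (k + 1) = (2 * k + 1) + 1 by ring, pow_succ', pow_succ]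
  rfl

-- The kernel `λ ^ (2 * max i j) - λ ^ (2 * i) * λ ^ (2 * j)` is positive semidefinite for
-- `|λ| ≤ 1`. The induction splits off the index `0` and replaces the remaining `h (i + 1)`
-- by `T (h (i + 1))`.
theorem norm_sq_sum_even_pow_le (hT : T.IsSymmetric) (hc : ∀ x, ‖T x‖ ≤ ‖x‖) (n : ℕ)
    (h : ℕ → E) :
    ‖∑ i ∈ range n, (T ^ (2 * i)) (h i)‖ ^ 2 ≤
      ∑ i ∈ range n, ∑ j ∈ range n, ⟪(T ^ (2 * max i j)) (h i), h j⟫_ℝ := by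
  induction n generalizing h with
  | zero => simp
  | succ n ih =>
    set w := ∑ i ∈ range n, (T ^ (2 * i)) (T (h (i + 1))) with hw
    have map_w : ∑ i ∈ range n, (T ^ (2 * (i + 1))) (h (i + 1)) = T w := by
      simp only [hw, map_sum, pow_two_mul_succ_apply]
    have corner : ∑ i ∈ range n, ∑ j ∈ range n,
        ⟪(T ^ (2 * max (i + 1) (j + 1))) (h (i + 1)), h (j + 1)⟫_ℝ =
        ∑ i ∈ range n, ∑ j ∈ range n,
          ⟪(T ^ (2 * max i j)) (T (h (i + 1))), T (h (j + 1))⟫_ℝ := by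
      simp only [max_add_add_right, pow_two_mul_succ_apply, hT _ _]
    have column : ∑ i ∈ range n, ⟪(T ^ (2 * (i + 1))) (h (i + 1)), h 0⟫_ℝ = ⟪T w, h 0⟫_ℝ := by
      rw [← sum_inner, map_w]
    have row : ∑ j ∈ range n, ⟪(T ^ (2 * (j + 1))) (h 0), h (j + 1)⟫_ℝ = ⟪T w, h 0⟫_ℝ := by
      simp only [hT.pow _ _ _]
      rw [← inner_sum, map_w, real_inner_comm]
    calc ‖∑ i ∈ range (n + 1), (T ^ (2 * i)) (h i)‖ ^ 2
        = ‖T w + h 0‖ ^ 2 := by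
          rw [sum_range_succ', map_w, mul_zero, pow_zero, Module.End.one_apply]
      _ = ‖T w‖ ^ 2 + 2 * ⟪T w, h 0⟫_ℝ + ‖h 0‖ ^ 2 := norm_add_sq_real _ _
      _ ≤ ‖w‖ ^ 2 + 2 * ⟪T w, h 0⟫_ℝ + ‖h 0‖ ^ 2 := by gcongr; apply hc
      _ ≤ ∑ i ∈ range n, ∑ j ∈ range n, ⟪(T ^ (2 * max i j)) (T (h (i + 1))), T (h (j + 1))⟫_ℝ +
            2 * ⟪T w, h 0⟫_ℝ + ‖h 0‖ ^ 2 := by gcongr; exact ih fun i => T (h (i + 1))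
      _ = ∑ i ∈ range (n + 1), ∑ j ∈ range (n + 1), ⟪(T ^ (2 * max i j)) (h i), h j⟫_ℝ := by
          simp only [sum_range_succ' _ n, sum_add_distrib, corner, column, row, Nat.max_zero,
            Nat.zero_max, mul_zero, pow_zero, Module.End.one_apply, real_inner_self_eq_norm_sq]
          ring

theorem norm_sum_even_pow_le (hT : T.IsSymmetric) (hc : ∀ x, ‖T x‖ ≤ ‖x‖) {n : ℕ} {h : ℕ → E}
    (hpos : ∀ k i j, 0 ≤ ⟪(T ^ (2 * k)) (h i), h j⟫_ℝ) :
    ‖∑ i ∈ range n, (T ^ (2 * i)) (h i)‖ ≤ 2 * ‖∑ i ∈ range n, h i‖ := by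
  set w := ∑ i ∈ range n, (T ^ (2 * i)) (h i) with hw
  set F := ∑ i ∈ range n, h i with hF
  have inner_left : ∑ i ∈ range n, ∑ j ∈ range n, ⟪(T ^ (2 * i)) (h i), h j⟫_ℝ = ⟪w, F⟫_ℝ := by
    simp only [hw, hF, sum_inner, inner_sum]
    exact sum_comm
  have inner_right : ∑ i ∈ range n, ∑ j ∈ range n, ⟪(T ^ (2 * j)) (h i), h j⟫_ℝ = ⟪w, F⟫_ℝ := by
    rw [← inner_left, sum_comm]
    refine sum_congr rfl fun i _ => sum_congr rfl fun j _ => ?_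
    rw [hT.pow, real_inner_comm]
  refine le_of_sq_le_mul (by positivity) ?_
  calc ‖w‖ ^ 2 ≤ ∑ i ∈ range n, ∑ j ∈ range n, ⟪(T ^ (2 * max i j)) (h i), h j⟫_ℝ :=
        norm_sq_sum_even_pow_le hT hc n h
    _ ≤ ∑ i ∈ range n, ∑ j ∈ range n,
          (⟪(T ^ (2 * i)) (h i), h j⟫_ℝ + ⟪(T ^ (2 * j)) (h i), h j⟫_ℝ) := by
        gcongr with i _ j _
        rcases max_choice i j with e | e <;> rw [e] <;> linarith [hpos i i j, hpos j i j]
    _ = 2 * ⟪w, F⟫_ℝ := by simp only [sum_add_distrib, inner_left, inner_right]; ring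
    _ ≤ 2 * (‖w‖ * ‖F‖) := by gcongr; exact real_inner_le_norm w F
    _ = 2 * ‖F‖ * ‖w‖ := by ring

-- With `h i` the part of `(T ^ (2 * i)) f` on the set where a maximal function is attained at
-- `i`, the sum of the `h i` is that maximal function and `hself` holds.
theorem norm_sum_le_of_norm_sq_eq_sum_inner (hT : T.IsSymmetric) (hc : ∀ x, ‖T x‖ ≤ ‖x‖) {n : ℕ}
    {h : ℕ → E} (hpos : ∀ k i j, 0 ≤ ⟪(T ^ (2 * k)) (h i), h j⟫_ℝ) {f : E}
    (hself : ‖∑ i ∈ range n, h i‖ ^ 2 = ∑ i ∈ range n, ⟪(T ^ (2 * i)) f, h i⟫_ℝ) :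
    ‖∑ i ∈ range n, h i‖ ≤ 2 * ‖f‖ := by
  refine le_of_sq_le_mul (by positivity) ?_
  calc ‖∑ i ∈ range n, h i‖ ^ 2 = ⟪f, ∑ i ∈ range n, (T ^ (2 * i)) (h i)⟫_ℝ := by
        simp only [hself, hT.pow _ _ _, inner_sum]
    _ ≤ ‖f‖ * ‖∑ i ∈ range n, (T ^ (2 * i)) (h i)‖ := real_inner_le_norm _ _
    _ ≤ ‖f‖ * (2 * ‖∑ i ∈ range n, h i‖) := by gcongr; exact norm_sum_even_pow_le hT hc hpos
    _ = 2 * ‖f‖ * ‖∑ i ∈ range n, h i‖ := by ring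

variable {α : Type*}

theorem inner_nonneg_of_forall_nonneg {u v : ℓ²(α, ℝ)} (hu : ∀ x, 0 ≤ u x) (hv : ∀ x, 0 ≤ v x) :
    0 ≤ ⟪u, v⟫_ℝ := by
  rw [lp.inner_eq_tsum]
  exact tsum_nonneg fun x => mul_nonneg (hv x) (hu x)

/-- The product of `f ∈ ℓ²` with the indicator function of `s`. -/
noncomputable def lpIndicator (s : Set α) (f : ℓ²(α, ℝ)) : ℓ²(α, ℝ) :=
  ⟨s.indicator f, (lp.memℓp f).mono' fun x => norm_indicator_le_norm_self f x⟩

theorem lpIndicator_apply (s : Set α) (f : ℓ²(α, ℝ)) (x : α) :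
    lpIndicator s f x = s.indicator f x := rfl

theorem inner_lpIndicator_congr {s : Set α} {u v : ℓ²(α, ℝ)} (h : ∀ x ∈ s, u x = v x)
    (g : ℓ²(α, ℝ)) : ⟪u, lpIndicator s g⟫_ℝ = ⟪v, lpIndicator s g⟫_ℝ := by
  rw [lp.inner_eq_tsum, lp.inner_eq_tsum]
  refine tsum_congr fun x => ?_
  by_cases hx : x ∈ s
  · rw [h x hx]
  · simp only [lpIndicator_apply, Set.indicator_of_notMem hx, inner_zero_right]

/-- An operator on `ℓ²` that maps pointwise non-negative functions to such functions. -/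
def IsPositivityPreserving (T : ℓ²(α, ℝ) →ₗ[ℝ] ℓ²(α, ℝ)) : Prop :=
  ∀ ⦃f : ℓ²(α, ℝ)⦄, (∀ x, 0 ≤ f x) → ∀ x, 0 ≤ T f x

theorem IsPositivityPreserving.pow {T : ℓ²(α, ℝ) →ₗ[ℝ] ℓ²(α, ℝ)} (hT : IsPositivityPreserving T)
    (k : ℕ) : IsPositivityPreserving (T ^ k) := by
  induction k with
  | zero => exact fun f hf => hf
  | succ k ih =>
    rw [pow_succ]
    exact fun f hf => ih (hT hf)

variable {T : ℓ²(α, ℝ) →ₗ[ℝ] ℓ²(α, ℝ)} {f : ℓ²(α, ℝ)}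

theorem exists_eq_even_pow_apply_norm_le (hT : T.IsSymmetric) (hc : ∀ f, ‖T f‖ ≤ ‖f‖)
    (hpos : IsPositivityPreserving T) (hf : ∀ x, 0 ≤ f x) {n : ℕ} {m : α → ℕ}
    (hm : ∀ x, m x < n) :
    ∃ F : ℓ²(α, ℝ), (∀ x, F x = (T ^ (2 * m x)) f x) ∧ ‖F‖ ≤ 2 * ‖f‖ := by
  let h : ℕ → ℓ²(α, ℝ) := fun i => lpIndicator {x | m x = i} ((T ^ (2 * i)) f)
  have h_nonneg : ∀ i x, 0 ≤ h i x := fun i =>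
    Set.indicator_nonneg fun x _ => hpos.pow _ hf x
  have sum_apply : ∀ x, (∑ i ∈ range n, h i) x = (T ^ (2 * m x)) f x := fun x => by
    rw [lp.coeFn_sum, Finset.sum_apply]
    simp only [h, lpIndicator_apply, Set.indicator_apply, Set.mem_ofPred_eq]
    rw [sum_ite_eq, if_pos (mem_range.2 (hm x))]
  refine ⟨∑ i ∈ range n, h i, sum_apply, norm_sum_le_of_norm_sq_eq_sum_inner hT hc
    (fun k i j => inner_nonneg_of_forall_nonneg (hpos.pow _ (h_nonneg i)) (h_nonneg j)) ?_⟩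
  rw [← real_inner_self_eq_norm_sq, inner_sum]
  refine sum_congr rfl fun i _ => inner_lpIndicator_congr ?_ _
  rintro x rfl
  exact sum_apply x

theorem exists_even_pow_le_norm_le (hT : T.IsSymmetric) (hc : ∀ f, ‖T f‖ ≤ ‖f‖)
    (hpos : IsPositivityPreserving T) (hf : ∀ x, 0 ≤ f x) (n : ℕ) :
    ∃ F : ℓ²(α, ℝ), (∀ i ≤ n, ∀ x, (T ^ (2 * i)) f x ≤ F x) ∧ ‖F‖ ≤ 2 * ‖f‖ := by
  have attained : ∀ x, ∃ m ∈ range (n + 1), ∀ i ∈ range (n + 1),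
      (T ^ (2 * i)) f x ≤ (T ^ (2 * m)) f x := fun x =>
    exists_max_image _ _ nonempty_range_add_one
  choose m hm hmax using attained
  obtain ⟨F, hF, hFf⟩ := exists_eq_even_pow_apply_norm_le hT hc hpos hf fun x => mem_range.1 (hm x)
  exact ⟨F, fun i hi x => (hF x).symm ▸ hmax x i (mem_range_succ_iff.2 hi), hFf⟩

-- An odd power of `T` applied to `f` is an even power applied to `T f`.
theorem exists_pow_le_norm_le (hT : T.IsSymmetric) (hc : ∀ f, ‖T f‖ ≤ ‖f‖)
    (hpos : IsPositivityPreserving T) (hf : ∀ x, 0 ≤ f x) (n : ℕ) :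
    ∃ F : ℓ²(α, ℝ), (∀ i ≤ n, ∀ x, (T ^ i) f x ≤ F x) ∧ ‖F‖ ≤ 4 * ‖f‖ := by
  obtain ⟨F₀, hF₀, hn₀⟩ := exists_even_pow_le_norm_le hT hc hpos hf n
  obtain ⟨F₁, hF₁, hn₁⟩ := exists_even_pow_le_norm_le hT hc hpos (hpos hf) n
  have F₀_nonneg : ∀ x, 0 ≤ F₀ x := fun x => (hf x).trans (hF₀ 0 n.zero_le x)
  have F₁_nonneg : ∀ x, 0 ≤ F₁ x := fun x => (hpos hf x).trans (hF₁ 0 n.zero_le x)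
  refine ⟨F₀ + F₁, fun i hi x => ?_, ?_⟩
  · rw [lp.coeFn_add, Pi.add_apply]
    obtain ⟨k, rfl | rfl⟩ := i.even_or_odd'
    · linarith [hF₀ k (by lia) x, F₁_nonneg x]
    · rw [pow_succ, Module.End.mul_apply]
      linarith [hF₁ k (by lia) x, F₀_nonneg x]
  · linarith [norm_add_le F₀ F₁, hc f]

end Stein

section StepAverage

open Finset
open scoped lp InnerProductSpace

variable {G ι : Type*} [AddCommGroup G]

/-- Translation by `v` on `ℓ²(G)`. -/
noncomputable def lpTranslate (v : G) : ℓ²(G, ℝ) →ₗ[ℝ] ℓ²(G, ℝ) where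
  toFun f := ⟨fun x => f (x - v), memℓp_gen <|
    (Equiv.subRight v).summable_iff.2 ((lp.memℓp f).summable (by norm_num))⟩
  map_add' _ _ := rfl
  map_smul' _ _ := rfl

theorem lpTranslate_apply (v : G) (f : ℓ²(G, ℝ)) (x : G) : lpTranslate v f x = f (x - v) := rfl

theorem norm_lpTranslate (v : G) (f : ℓ²(G, ℝ)) : ‖lpTranslate v f‖ = ‖f‖ := by
  rw [lp.norm_eq_tsum_rpow (by norm_num), lp.norm_eq_tsum_rpow (by norm_num)]
  congr 1
  exact (Equiv.subRight v).tsum_eq fun x => ‖f x‖ ^ (2 : ℝ≥0∞).toReal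

theorem inner_lpTranslate_left (v : G) (f g : ℓ²(G, ℝ)) :
    ⟪lpTranslate v f, g⟫_ℝ = ⟪f, lpTranslate (-v) g⟫_ℝ := by
  rw [lp.inner_eq_tsum, lp.inner_eq_tsum, ← (Equiv.addRight v).tsum_eq]
  simp only [lpTranslate_apply, Equiv.coe_addRight, add_sub_cancel_right, sub_neg_eq_add]

variable [Fintype ι]

/-- The averaging operator `f ↦ ∑ i, w i * f (· - v i)` on `ℓ²(G)`, that is, the transition
operator of the random walk on `G` that makes the step `v i` with probability `w i`. -/
noncomputable def stepAverage (w : ι → ℝ) (v : ι → G) : ℓ²(G, ℝ) →ₗ[ℝ] ℓ²(G, ℝ) :=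
  ∑ i, w i • lpTranslate (v i)

theorem stepAverage_apply (w : ι → ℝ) (v : ι → G) (f : ℓ²(G, ℝ)) (x : G) :
    stepAverage w v f x = ∑ i, w i * f (x - v i) := by
  rw [stepAverage, LinearMap.sum_apply, lp.coeFn_sum, Finset.sum_apply]
  rfl

variable {w : ι → ℝ} {v : ι → G}

theorem isPositivityPreserving_stepAverage (hw : ∀ i, 0 ≤ w i) (v : ι → G) :
    IsPositivityPreserving (stepAverage w v) := fun f hf x => by
  rw [stepAverage_apply]
  exact sum_nonneg fun i _ => mul_nonneg (hw i) (hf _)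

theorem norm_stepAverage_le (hw : ∀ i, 0 ≤ w i) (hw₁ : ∑ i, w i ≤ 1) (v : ι → G)
    (f : ℓ²(G, ℝ)) : ‖stepAverage w v f‖ ≤ ‖f‖ := by
  rw [stepAverage, LinearMap.sum_apply]
  calc ‖∑ i, (w i • lpTranslate (v i)) f‖ ≤ ∑ i, w i * ‖f‖ := by
        refine norm_sum_le_of_le _ fun i _ => ?_
        rw [LinearMap.smul_apply, norm_smul, norm_lpTranslate, Real.norm_of_nonneg (hw i)]
    _ = (∑ i, w i) * ‖f‖ := by rw [sum_mul]
    _ ≤ ‖f‖ := mul_le_of_le_one_left (norm_nonneg _) hw₁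

theorem isSymmetric_stepAverage (e : ι ≃ ι) (hw : ∀ i, w (e i) = w i)
    (hv : ∀ i, v (e i) = -v i) : (stepAverage w v).IsSymmetric := by
  intro f g
  simp only [stepAverage, LinearMap.sum_apply, LinearMap.smul_apply, sum_inner, inner_sum,
    real_inner_smul_left, real_inner_smul_right]
  rw [← e.sum_comp]
  exact sum_congr rfl fun i _ => by rw [hw, hv, inner_lpTranslate_left, neg_neg]

-- The kernel of a power of the walk is that power applied to the point mass at `0`.
theorem sum_kernel_mul_le_stepAverage_pow [DecidableEq G] (hw : ∀ i, 0 ≤ w i) (v : ι → G)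
    {f : ℓ²(G, ℝ)} (hf : ∀ x, 0 ≤ f x) (n : ℕ) (s : Finset G) (x : G) :
    ∑ y ∈ s, (stepAverage w v ^ n) (lp.single 2 0 1) y * f (x - y) ≤
      (stepAverage w v ^ n) f x := by
  induction n generalizing s x with
  | zero =>
    simp only [pow_zero, Module.End.one_apply, lp.single_apply, Pi.single_apply, ite_mul, one_mul,
      zero_mul, sum_ite_eq']
    split_ifs
    · rw [sub_zero]
    · exact hf x
  | succ n ih =>
    simp only [pow_succ', Module.End.mul_apply, stepAverage_apply]
    calc ∑ y ∈ s, (∑ i, w i * (stepAverage w v ^ n) (lp.single 2 0 1) (y - v i)) * f (x - y)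
        = ∑ i, w i * ∑ y ∈ s.map (Equiv.subRight (v i)).toEmbedding,
            (stepAverage w v ^ n) (lp.single 2 0 1) y * f (x - v i - y) := by
          simp only [sum_mul, mul_sum, sum_map, Equiv.coe_toEmbedding, Equiv.subRight_apply,
            sub_sub_sub_cancel_right, mul_assoc]
          exact sum_comm
      _ ≤ ∑ i, w i * (stepAverage w v ^ n) f (x - v i) := by
          gcongr with i
          exacts [hw i, ih _ _]

end StepAverage

section AxisWalk

open Finset
open scoped lp Nat

variable {d : ℕ} {a : ℝ}

/-- The step `± (k + 1) e_i` of `ℤ^d`, encoded by `(i, k, ± 1)`. -/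
def axisStep (q : Fin d × Fin d × ℤˣ) : Fin d → ℤ :=
  Pi.single q.1 (q.2.2 * ((q.2.1 : ℕ) + 1))

/-- The weight of the step `± (k + 1) e_i`: the axis and the sign are uniformly distributed and
the length is geometric with ratio `a`, truncated at `d`. -/
noncomputable def axisWeight (a : ℝ) (q : Fin d × Fin d × ℤˣ) : ℝ :=
  (1 - a) / (2 * d) * a ^ (q.2.1 : ℕ)

/-- The transition operator of the random walk on `ℤ^d` with axis-parallel steps of truncated
geometric length. -/
noncomputable def axisWalk (d : ℕ) (a : ℝ) : ℓ²(Fin d → ℤ, ℝ) →ₗ[ℝ] ℓ²(Fin d → ℤ, ℝ) :=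
  stepAverage (axisWeight a) axisStep

theorem axisWeight_nonneg (ha₀ : 0 ≤ a) (ha₁ : a ≤ 1) (q : Fin d × Fin d × ℤˣ) :
    0 ≤ axisWeight a q := by
  have := sub_nonneg.2 ha₁
  unfold axisWeight
  positivity

theorem sum_axisWeight_le_one (ha₀ : 0 ≤ a) : ∑ q : Fin d × Fin d × ℤˣ, axisWeight a q ≤ 1 := by
  rcases eq_or_ne d 0 with rfl | hd
  · simp
  calc ∑ q : Fin d × Fin d × ℤˣ, axisWeight a q
      = (1 - a) * ∑ k ∈ range d, a ^ k := by
        simp only [axisWeight, Fintype.sum_prod_type, sum_const, card_univ,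
          Fintype.card_units_int, Fintype.card_fin, nsmul_eq_mul, ← mul_sum,
          Fin.sum_univ_eq_sum_range (fun k => a ^ k)]
        push_cast
        field
    _ = 1 - a ^ d := mul_neg_geom_sum a d
    _ ≤ 1 := sub_le_self _ (pow_nonneg ha₀ d)

theorem isPositivityPreserving_axisWalk (ha₀ : 0 ≤ a) (ha₁ : a ≤ 1) :
    IsPositivityPreserving (axisWalk d a) :=
  isPositivityPreserving_stepAverage (axisWeight_nonneg ha₀ ha₁) axisStep

theorem axisWalk_pow_single_nonneg (ha₀ : 0 ≤ a) (ha₁ : a ≤ 1) (n : ℕ) (y : Fin d → ℤ) :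
    0 ≤ (axisWalk d a ^ n) (lp.single 2 0 1) y := by
  refine (isPositivityPreserving_axisWalk ha₀ ha₁).pow n (fun x => ?_) y
  rw [lp.single_apply, Pi.single_apply]
  split_ifs <;> norm_num

theorem norm_axisWalk_le (ha₀ : 0 ≤ a) (ha₁ : a ≤ 1) (f : ℓ²(Fin d → ℤ, ℝ)) :
    ‖axisWalk d a f‖ ≤ ‖f‖ :=
  norm_stepAverage_le (axisWeight_nonneg ha₀ ha₁) (sum_axisWeight_le_one ha₀) axisStep f

theorem isSymmetric_axisWalk (d : ℕ) (a : ℝ) : (axisWalk d a).IsSymmetric :=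
  isSymmetric_stepAverage (.prodCongr (.refl _) (.prodCongr (.refl _) (.neg _)))
    (fun _ => rfl) fun q => by simp [axisStep, Pi.single_neg]

theorem exists_axisStep_eq_single {z : ℤ} (hz : z ≠ 0) (hzd : z.natAbs ≤ d) (a : ℝ) (i : Fin d) :
    ∃ q, axisStep (i, q) = Pi.single i z ∧
      axisWeight a (i, q) = (1 - a) / (2 * d) * a ^ (z.natAbs - 1) := by
  have hz' : 0 < z.natAbs := Int.natAbs_pos.2 hz
  obtain ⟨u, hu⟩ : ∃ u : ℤˣ, u * (z.natAbs : ℤ) = z := by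
    rcases z.natAbs_eq with h | h
    · exact ⟨1, by simpa using h.symm⟩
    · exact ⟨-1, by simpa using h.symm⟩
  refine ⟨(⟨z.natAbs - 1, by lia⟩, u), ?_, rfl⟩
  simp only [axisStep]
  rw [← Nat.cast_succ, Nat.succ_eq_add_one, Nat.sub_add_cancel hz', hu]

theorem sum_support_le_axisWalk (ha₀ : 0 ≤ a) (ha₁ : a ≤ 1) {g : ℓ²(Fin d → ℤ, ℝ)}
    (hg : ∀ x, 0 ≤ g x) {y : Fin d → ℤ} (hy : ∀ i, (y i).natAbs ≤ d) :
    ∑ i with y i ≠ 0, (1 - a) / (2 * d) * a ^ ((y i).natAbs - 1) * g (Function.update y i 0) ≤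
      axisWalk d a g y := by
  have term_nonneg : ∀ q, 0 ≤ axisWeight a q * g (y - axisStep q) := fun q =>
    mul_nonneg (axisWeight_nonneg ha₀ ha₁ q) (hg _)
  rw [axisWalk, stepAverage_apply, Fintype.sum_prod_type]
  refine (sum_le_sum fun i hi => ?_).trans (sum_le_sum_of_subset_of_nonneg (filter_subset _ _)
    fun i _ _ => sum_nonneg fun q _ => term_nonneg (i, q))
  obtain ⟨q, hstep, hweight⟩ := exists_axisStep_eq_single (mem_filter.1 hi).2 (hy i) a i
  calc (1 - a) / (2 * d) * a ^ ((y i).natAbs - 1) * g (Function.update y i 0)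
      = axisWeight a (i, q) * g (y - axisStep (i, q)) := by
        rw [hstep, hweight, Pi.update_eq_sub_add_single, Pi.single_zero, add_zero]
    _ ≤ ∑ q, axisWeight a (i, q) * g (y - axisStep (i, q)) :=
        single_le_sum (f := fun q => axisWeight a (i, q) * g (y - axisStep (i, q)))
          (fun q _ => term_nonneg (i, q)) (mem_univ q)

theorem card_support_update_zero_add_one {ι M : Type*} [Fintype ι] [DecidableEq ι] [Zero M]
    [DecidableEq M] {y : ι → M} {i : ι} (hi : y i ≠ 0) :
    #{j | Function.update y i 0 j ≠ 0} + 1 = #{j | y j ≠ 0} := by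
  have support_eq : ({j | Function.update y i 0 j ≠ 0} : Finset ι) =
      ({j | y j ≠ 0} : Finset ι).erase i := by
    ext j
    rcases eq_or_ne j i with rfl | hj
    · simp
    · simp [hj]
  rw [support_eq, card_erase_add_one (mem_filter.2 ⟨mem_univ i, hi⟩)]

theorem add_sum_update_zero {ι M N : Type*} [Fintype ι] [DecidableEq ι] [Zero M]
    [AddCommMonoid N] {h : M → N} (h₀ : h 0 = 0) (y : ι → M) (i : ι) :
    h (y i) + ∑ j, h (Function.update y i 0 j) = ∑ j, h (y j) := by
  rw [← add_sum_erase _ _ (mem_univ i), ← add_sum_erase _ (fun j => h (y j)) (mem_univ i),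
    Function.update_self, h₀, zero_add]
  congr 1
  exact sum_congr rfl fun j hj => by rw [Function.update_of_ne (ne_of_mem_erase hj)]

-- The walk reaches `y` in as many steps as `y` has non-zero coordinates by making these
-- coordinates right one at a time, in any of the `n !` orders. The truncated subtraction makes
-- the zero coordinates contribute nothing to the exponent.
theorem factorial_mul_le_axisWalk_pow (ha₀ : 0 ≤ a) (ha₁ : a ≤ 1) {n : ℕ} {y : Fin d → ℤ}
    (hy : ∀ i, (y i).natAbs ≤ d) (hn : #{i | y i ≠ 0} = n) :
    n ! * ((1 - a) / (2 * d)) ^ n * a ^ (∑ i, ((y i).natAbs - 1)) ≤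
      (axisWalk d a ^ n) (lp.single 2 0 1) y := by
  induction n generalizing y with
  | zero =>
    obtain rfl : y = 0 := by
      ext i
      simpa using filter_eq_empty_iff.1 (card_eq_zero.1 hn) (mem_univ i)
    simp
  | succ n ih =>
    set c := (1 - a) / (2 * d)
    have : 0 ≤ c := div_nonneg (sub_nonneg.2 ha₁) (by positivity)
    have ih_update : ∀ i, y i ≠ 0 →
        n ! * c ^ n * a ^ (∑ j, ((Function.update y i 0 j).natAbs - 1)) ≤
          (axisWalk d a ^ n) (lp.single 2 0 1) (Function.update y i 0) := fun i hi => by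
      refine ih (fun j => ?_) (by have := card_support_update_zero_add_one hi; lia)
      rcases eq_or_ne j i with rfl | hj
      · simp
      · simpa [hj] using hy j
    have pow_split : ∀ i, a ^ ((y i).natAbs - 1) *
        a ^ (∑ j, ((Function.update y i 0 j).natAbs - 1)) = a ^ (∑ i, ((y i).natAbs - 1)) :=
      fun i => by rw [← pow_add, add_sum_update_zero (h := fun z : ℤ => z.natAbs - 1) rfl]
    rw [pow_succ' (axisWalk d a), Module.End.mul_apply]
    calc ((n + 1)! : ℝ) * c ^ (n + 1) * a ^ (∑ i, ((y i).natAbs - 1))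
        = ∑ i with y i ≠ 0, n ! * c ^ (n + 1) * a ^ (∑ i, ((y i).natAbs - 1)) := by
          rw [sum_const, hn, nsmul_eq_mul, Nat.factorial_succ]
          push_cast
          ring
      _ = ∑ i with y i ≠ 0, c * a ^ ((y i).natAbs - 1) *
            (n ! * c ^ n * a ^ (∑ j, ((Function.update y i 0 j).natAbs - 1))) :=
          sum_congr rfl fun i _ => by rw [← pow_split i]; ring
      _ ≤ ∑ i with y i ≠ 0, c * a ^ ((y i).natAbs - 1) *
            (axisWalk d a ^ n) (lp.single 2 0 1) (Function.update y i 0) := by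
          gcongr with i hi
          exact ih_update i (mem_filter.1 hi).2
      _ ≤ axisWalk d a ((axisWalk d a ^ n) (lp.single 2 0 1)) y :=
          sum_support_le_axisWalk ha₀ ha₁ (axisWalk_pow_single_nonneg ha₀ ha₁ n) hy

end AxisWalk

section BallPoints

open Finset
open scoped Nat

variable {d : ℕ} {t : ℝ} {N j : ℕ}

theorem mem_l1BallPoints (ht : 0 ≤ t) {y : Fin d → ℤ} :
    y ∈ l1BallPoints d t ↔ ∑ i, (y i).natAbs ≤ ⌊t⌋₊ := by
  rw [Nat.le_floor_iff ht, l1BallPoints, Set.Finite.mem_toFinset, dilateLatticePoints,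
    Set.mem_ofPred_eq]
  rcases ht.eq_or_lt with rfl | ht
  · have ball_nonempty : (l1UnitBall d).Nonempty := ⟨0, by simp [l1UnitBall]⟩
    rw [Set.zero_smul_set ball_nonempty, Set.mem_zero, Nat.cast_nonpos, sum_eq_zero_iff,
      funext_iff]
    simp
  · rw [Set.mem_smul_set_iff_inv_smul_mem₀ ht.ne', l1UnitBall, Set.mem_ofPred_eq, Nat.cast_sum]
    simp only [Pi.smul_apply, smul_eq_mul, abs_mul, abs_of_pos (inv_pos.2 ht), ← mul_sum,
      Nat.cast_natAbs, Int.cast_abs]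
    rw [inv_mul_le_iff₀ ht, mul_one]

theorem l1BallPoints_natFloor (d : ℕ) (ht : 0 ≤ t) : l1BallPoints d ⌊t⌋₊ = l1BallPoints d t := by
  ext y
  rw [mem_l1BallPoints ht, mem_l1BallPoints (Nat.cast_nonneg _), Nat.floor_natCast]

theorem zero_mem_l1BallPoints (d : ℕ) (ht : 0 ≤ t) : 0 ∈ l1BallPoints d t := by
  simp [mem_l1BallPoints ht]

theorem card_sigma_powersetCard_powerset {α : Type*} (s : Finset α) (n : ℕ) :
    #((powersetCard n s).sigma powerset) = (#s).choose n * 2 ^ n := by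
  rw [card_sigma, sum_congr rfl fun u hu => by rw [card_powerset, (mem_powersetCard.1 hu).2],
    sum_const, card_powersetCard, smul_eq_mul]

/-- The vector with entries in `{-1, 0, 1}` whose support is `q.1` and which is negative exactly
on `q.2`, for `q.2 ⊆ q.1`. -/
def signedIndicator {ι : Type*} [DecidableEq ι] (q : Σ _ : Finset ι, Finset ι) (i : ι) : ℤ :=
  if i ∈ q.1 then if i ∈ q.2 then -1 else 1 else 0

theorem natAbs_signedIndicator {ι : Type*} [DecidableEq ι] (q : Σ _ : Finset ι, Finset ι) (i : ι) :
    (signedIndicator q i).natAbs = if i ∈ q.1 then 1 else 0 := by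
  unfold signedIndicator
  split_ifs <;> rfl

theorem signedIndicator_injOn {ι : Type*} [DecidableEq ι] :
    Set.InjOn signedIndicator {q : Σ _ : Finset ι, Finset ι | q.2 ⊆ q.1} := by
  have mem_fst : ∀ (q : Σ _ : Finset ι, Finset ι) i, i ∈ q.1 ↔ signedIndicator q i ≠ 0 := by
    intro q i
    unfold signedIndicator
    split_ifs <;> simp [*]
  have mem_snd : ∀ q : Σ _ : Finset ι, Finset ι, q.2 ⊆ q.1 →
      ∀ i, i ∈ q.2 ↔ signedIndicator q i < 0 := by
    intro q hq i
    unfold signedIndicator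
    split_ifs with h₁ h₂ <;> grind
  rintro ⟨s, u⟩ hq ⟨s', u'⟩ hq' h
  obtain rfl : s = s' := ext fun i => by rw [mem_fst ⟨s, u⟩, h, ← mem_fst]
  obtain rfl : u = u' := ext fun i => by rw [mem_snd ⟨s, u⟩ hq, h, ← mem_snd _ hq']
  rfl

theorem choose_mul_two_pow_le_card_l1BallPoints (d N : ℕ) :
    d.choose N * 2 ^ N ≤ #(l1BallPoints d N) := by
  rw [← card_fin d, ← card_sigma_powersetCard_powerset, card_fin]
  refine card_le_card_of_injOn signedIndicator (fun q hq => ?_)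
    (signedIndicator_injOn.mono fun q hq => mem_powerset.1 (mem_sigma.1 hq).2)
  have hcard : #q.1 = N := (mem_powersetCard.1 (mem_sigma.1 hq).1).2
  rw [mem_coe, mem_l1BallPoints N.cast_nonneg, Nat.floor_natCast]
  simp only [natAbs_signedIndicator, sum_boole, filter_univ_mem, hcard, Nat.cast_id, le_refl]

theorem mul_pow_le_mul_descFactorial_add (d n : ℕ) :
    d * d ^ n ≤ d * d.descFactorial n + n.choose 2 * d ^ n := by
  induction n with
  | zero => simp
  | succ n ih =>
    have descFactorial_le : d * d.descFactorial n ≤ d.descFactorial (n + 1) + n * d ^ n := by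
      rw [Nat.descFactorial_succ]
      calc d * d.descFactorial n ≤ ((d - n) + n) * d.descFactorial n := by gcongr; lia
        _ ≤ (d - n) * d.descFactorial n + n * d ^ n := by
          rw [add_mul]; gcongr; exact d.descFactorial_le_pow n
    calc d * d ^ (n + 1) = d * (d * d ^ n) := by ring
      _ ≤ d * (d * d.descFactorial n + n.choose 2 * d ^ n) := by gcongr
      _ ≤ d * (d.descFactorial (n + 1) + n * d ^ n + n.choose 2 * d ^ n) := by gcongr
      _ = d * d.descFactorial (n + 1) + (n + 1).choose 2 * d ^ (n + 1) := by
        rw [Nat.choose_succ_succ' n 1, Nat.choose_one_right]; ring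

theorem pow_le_two_mul_descFactorial (hN : N ^ 2 ≤ d) : d ^ N ≤ 2 * d.descFactorial N := by
  rcases d.eq_zero_or_pos with rfl | hd
  · obtain rfl : N = 0 := by nlinarith
    simp
  have two_mul_choose_le : 2 * N.choose 2 ≤ d :=
    calc 2 * N.choose 2 ≤ N * (N - 1) := by rw [Nat.choose_two_right]; exact Nat.mul_div_le _ 2
      _ ≤ N * N := by gcongr; exact N.sub_le 1
      _ ≤ d := by rwa [← sq]
  refine le_of_mul_le_mul_left ?_ hd
  have := mul_pow_le_mul_descFactorial_add d N
  have : 2 * N.choose 2 * d ^ N ≤ d * d ^ N := by gcongr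
  linarith

theorem two_mul_pow_le_card_l1BallPoints (hN : N ^ 2 ≤ d) :
    (2 * d) ^ N ≤ 2 * N ! * #(l1BallPoints d N) :=
  calc (2 * d) ^ N = 2 ^ N * d ^ N := mul_pow 2 d N
    _ ≤ 2 ^ N * (2 * d.descFactorial N) := by gcongr; exact pow_le_two_mul_descFactorial hN
    _ = 2 * N ! * (d.choose N * 2 ^ N) := by rw [Nat.descFactorial_eq_factorial_mul_choose]; ring
    _ ≤ 2 * N ! * #(l1BallPoints d N) := by
      gcongr; exact choose_mul_two_pow_le_card_l1BallPoints d N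

theorem factorial_le_factorial_mul_pow_sub (hj : j ≤ N) : N ! ≤ j ! * N ^ (N - j) := by
  rw [← Nat.factorial_mul_descFactorial (N.sub_le j), Nat.sub_sub_self hj]
  gcongr
  exact N.descFactorial_le_pow (N - j)

theorem inv_card_l1BallPoints_le (hN : N ^ 2 ≤ d) (hj : j ≤ N) :
    (#(l1BallPoints d N) : ℝ)⁻¹ ≤ 2 * j ! / (2 * d) ^ j * ((√d)⁻¹ / 2) ^ (N - j) := by
  have hpow_pos : (0 : ℝ) < (2 * d) ^ N := by
    rcases N.eq_zero_or_pos with rfl | hN₀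
    · simp
    · have : 0 < d := by nlinarith
      positivity
  have hcard : (2 * d : ℝ) ^ N ≤ 2 * N ! * #(l1BallPoints d N) := by
    exact_mod_cast two_mul_pow_le_card_l1BallPoints hN
  have hfac : (N ! : ℝ) ≤ j ! * √d ^ (N - j) := by
    calc (N ! : ℝ) ≤ j ! * (N : ℝ) ^ (N - j) := by
          exact_mod_cast factorial_le_factorial_mul_pow_sub hj
      _ ≤ j ! * √d ^ (N - j) := by
          gcongr; exact Real.le_sqrt_of_sq_le (by exact_mod_cast hN)
  have hcard_pos : (0 : ℝ) < #(l1BallPoints d N) := by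
    exact_mod_cast card_pos.2 ⟨0, zero_mem_l1BallPoints d N.cast_nonneg⟩
  calc (#(l1BallPoints d N) : ℝ)⁻¹ ≤ 2 * N ! / (2 * d) ^ N := by
        rw [inv_eq_one_div, div_le_div_iff₀ hcard_pos hpow_pos, one_mul]
        exact hcard
    _ ≤ 2 * (j ! * √d ^ (N - j)) / (2 * d) ^ N := by gcongr
    _ = 2 * j ! / (2 * d) ^ j * (√d / (2 * d)) ^ (N - j) := by
        rw [← Nat.add_sub_of_le hj, pow_add, Nat.add_sub_of_le hj, div_pow]; ring
    _ = 2 * j ! / (2 * d) ^ j * ((√d)⁻¹ / 2) ^ (N - j) := by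
        rw [mul_comm (2 : ℝ) d, ← div_div √(d : ℝ), Real.sqrt_div_self]

end BallPoints

section Domination

open Finset
open scoped lp Nat

variable {d N : ℕ}

/-- The ratio of the geometric step lengths of the walk that dominates the averages over the
balls of radius at most `√d` in `ℤ^d`. -/
noncomputable def walkRatio (d : ℕ) : ℝ :=
  2 / 3 * (√d)⁻¹

theorem walkRatio_nonneg (d : ℕ) : 0 ≤ walkRatio d := by
  unfold walkRatio
  positivity

theorem walkRatio_le (d : ℕ) : walkRatio d ≤ 2 / 3 := by
  refine mul_le_of_le_one_right (by norm_num) ?_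
  rcases d.eq_zero_or_pos with rfl | hd
  · simp
  · exact inv_le_one_of_one_le₀ (Real.one_le_sqrt.2 (by exact_mod_cast hd))

theorem walkRatio_le_one (d : ℕ) : walkRatio d ≤ 1 :=
  (walkRatio_le d).trans (by norm_num)

theorem mul_walkRatio_le {j : ℕ} (hj : j ^ 2 ≤ d) : j * walkRatio d ≤ 2 / 3 := by
  have hj' : (j : ℝ) ≤ √d := Real.le_sqrt_of_sq_le (by exact_mod_cast hj)
  calc (j : ℝ) * walkRatio d = 2 / 3 * (j / √d) := by rw [walkRatio]; ring
    _ ≤ 2 / 3 * 1 := by gcongr; exact div_le_one_of_le₀ hj' (by positivity)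
    _ = 2 / 3 := mul_one _

theorem one_third_le_one_sub_walkRatio_pow {j : ℕ} (hj : j ^ 2 ≤ d) :
    1 / 3 ≤ (1 - walkRatio d) ^ j := by
  have bernoulli := one_add_mul_le_pow (a := -walkRatio d) (by linarith [walkRatio_le d]) j
  rw [← sub_eq_add_neg] at bernoulli
  linarith [mul_walkRatio_le hj]

theorem sum_natAbs_sub_one_add_card_support {ι : Type*} [Fintype ι] (y : ι → ℤ) :
    ∑ i, ((y i).natAbs - 1) + #{i | y i ≠ 0} = ∑ i, (y i).natAbs := by
  rw [card_filter, ← sum_add_distrib]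
  refine sum_congr rfl fun i _ => ?_
  split_ifs <;> lia

-- The index `j` is the number of non-zero coordinates of `y`. The factor `(3 / 4) ^ (N - j)` is
-- the gain of the ratio `(√d)⁻¹ / 2 = 3 / 4 * walkRatio d` of the counting bound over the ratio of
-- the walk.
theorem exists_inv_card_l1BallPoints_le (hN : N ^ 2 ≤ d) {y : Fin d → ℤ}
    (hy : y ∈ l1BallPoints d N) :
    ∃ j ≤ N, (#(l1BallPoints d N) : ℝ)⁻¹ ≤
      6 * (3 / 4) ^ (N - j) * (axisWalk d (walkRatio d) ^ j) (lp.single 2 0 1) y := by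
  rw [mem_l1BallPoints N.cast_nonneg, Nat.floor_natCast] at hy
  obtain ⟨j, hj⟩ : ∃ j, #{i | y i ≠ 0} = j := ⟨_, rfl⟩
  have excess := sum_natAbs_sub_one_add_card_support y
  have hjN : j ≤ N := by lia
  have natAbs_le : ∀ i, (y i).natAbs ≤ d := fun i =>
    calc (y i).natAbs ≤ ∑ i, (y i).natAbs :=
        single_le_sum (f := fun i => (y i).natAbs) (fun _ _ => Nat.zero_le _) (mem_univ i)
      _ ≤ N := hy
      _ ≤ d := (Nat.le_self_pow two_ne_zero N).trans hN
  set a := walkRatio d with ha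
  have ha₀ : 0 ≤ a := walkRatio_nonneg d
  have ha₁ : a ≤ 1 := walkRatio_le_one d
  have third_le : 1 / 3 ≤ (1 - a) ^ j := one_third_le_one_sub_walkRatio_pow (by nlinarith)
  have pow_excess_le : a ^ (N - j) ≤ a ^ (∑ i, ((y i).natAbs - 1)) :=
    pow_le_pow_of_le_one ha₀ ha₁ (by lia)
  refine ⟨j, hjN, ?_⟩
  calc (#(l1BallPoints d N) : ℝ)⁻¹ ≤ 2 * j ! / (2 * d) ^ j * ((√d)⁻¹ / 2) ^ (N - j) :=
        inv_card_l1BallPoints_le hN hjN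
    _ = 6 * (3 / 4) ^ (N - j) * (j ! * (1 / 3 / (2 * d) ^ j) * a ^ (N - j)) := by
        rw [show (√d)⁻¹ / 2 = 3 / 4 * a by rw [ha, walkRatio]; ring, mul_pow]
        ring
    _ ≤ 6 * (3 / 4) ^ (N - j) *
          (j ! * ((1 - a) / (2 * d)) ^ j * a ^ (∑ i, ((y i).natAbs - 1))) := by
        rw [div_pow (1 - a)]
        gcongr
    _ ≤ 6 * (3 / 4) ^ (N - j) * (axisWalk d a ^ j) (lp.single 2 0 1) y := by
        gcongr
        exact factorial_mul_le_axisWalk_pow ha₀ ha₁ natAbs_le hj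

theorem inv_card_l1BallPoints_le_sum (hN : N ^ 2 ≤ d) {y : Fin d → ℤ}
    (hy : y ∈ l1BallPoints d N) :
    (#(l1BallPoints d N) : ℝ)⁻¹ ≤ ∑ j ∈ range (N + 1),
      6 * (3 / 4) ^ (N - j) * (axisWalk d (walkRatio d) ^ j) (lp.single 2 0 1) y := by
  obtain ⟨j, hj, hle⟩ := exists_inv_card_l1BallPoints_le hN hy
  refine hle.trans (single_le_sum (f := fun j =>
    6 * (3 / 4) ^ (N - j) * (axisWalk d (walkRatio d) ^ j) (lp.single 2 0 1) y)
    (fun i _ => mul_nonneg (by positivity) ?_) (mem_range_succ_iff.2 hj))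
  exact axisWalk_pow_single_nonneg (walkRatio_nonneg d) (walkRatio_le_one d) i y

theorem sum_range_succ_pow_sub_le {r : ℝ} (hr₀ : 0 ≤ r) (hr₁ : r < 1) (n : ℕ) :
    ∑ j ∈ range (n + 1), r ^ (n - j) ≤ (1 - r)⁻¹ := by
  have reflect := sum_range_reflect (fun k => r ^ k) (n + 1)
  rw [Nat.add_sub_cancel] at reflect
  rw [reflect, ← tsum_geometric_of_lt_one hr₀ hr₁]
  exact (summable_geometric_of_lt_one hr₀ hr₁).sum_le_tsum _ fun k _ => pow_nonneg hr₀ k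

theorem sum_l1BallPoints_natCast_le (hN : N ^ 2 ≤ d) {g : ℓ²(Fin d → ℤ, ℝ)} (hg : ∀ x, 0 ≤ g x)
    {x : Fin d → ℤ} {C : ℝ} (hC : ∀ j ≤ N, (axisWalk d (walkRatio d) ^ j) g x ≤ C) :
    ∑ y ∈ l1BallPoints d N, (#(l1BallPoints d N) : ℝ)⁻¹ * g (x - y) ≤ 24 * C := by
  set T := axisWalk d (walkRatio d)
  have hC₀ : 0 ≤ C := (hg x).trans (hC 0 N.zero_le)
  have geometric : ∑ j ∈ range (N + 1), (3 / 4 : ℝ) ^ (N - j) ≤ 4 :=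
    (sum_range_succ_pow_sub_le (by norm_num) (by norm_num) N).trans_eq (by norm_num)
  calc ∑ y ∈ l1BallPoints d N, (#(l1BallPoints d N) : ℝ)⁻¹ * g (x - y)
      ≤ ∑ y ∈ l1BallPoints d N, (∑ j ∈ range (N + 1),
          6 * (3 / 4) ^ (N - j) * (T ^ j) (lp.single 2 0 1) y) * g (x - y) := by
        gcongr with y hy
        exacts [hg _, inv_card_l1BallPoints_le_sum hN hy]
    _ = ∑ j ∈ range (N + 1), 6 * (3 / 4) ^ (N - j) *
          ∑ y ∈ l1BallPoints d N, (T ^ j) (lp.single 2 0 1) y * g (x - y) := by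
        simp only [sum_mul, mul_sum, mul_assoc]
        exact sum_comm
    _ ≤ ∑ j ∈ range (N + 1), 6 * (3 / 4) ^ (N - j) * C := by
        gcongr with j hj
        exact (sum_kernel_mul_le_stepAverage_pow
          (axisWeight_nonneg (walkRatio_nonneg d) (walkRatio_le_one d)) axisStep hg j _ x).trans
          (hC j (mem_range_succ_iff.1 hj))
    _ = 6 * C * ∑ j ∈ range (N + 1), (3 / 4 : ℝ) ^ (N - j) := by
        rw [mul_sum]
        exact sum_congr rfl fun _ _ => by ring
    _ ≤ 6 * C * 4 := by gcongr
    _ = 24 * C := by ring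

theorem exists_sum_l1BallPoints_le_norm_le {g : ℓ²(Fin d → ℤ, ℝ)} (hg : ∀ x, 0 ≤ g x) :
    ∃ F : ℓ²(Fin d → ℤ, ℝ), (∀ t ∈ Set.Icc 0 √(d : ℝ), ∀ x,
      ∑ y ∈ l1BallPoints d t, (#(l1BallPoints d t) : ℝ)⁻¹ * g (x - y) ≤ F x) ∧
      ‖F‖ ≤ 96 * ‖g‖ := by
  obtain ⟨F, hF, hFg⟩ := exists_pow_le_norm_le (isSymmetric_axisWalk d (walkRatio d))
    (norm_axisWalk_le (walkRatio_nonneg d) (walkRatio_le_one d))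
    (isPositivityPreserving_axisWalk (walkRatio_nonneg d) (walkRatio_le_one d)) hg d
  refine ⟨(24 : ℝ) • F, fun t ht x => ?_, ?_⟩
  · have floor_sq_le : ⌊t⌋₊ ^ 2 ≤ d :=
      Nat.le_sqrt'.1 (Real.nat_floor_real_sqrt_eq_nat_sqrt (a := d) ▸ Nat.floor_mono ht.2)
    rw [← l1BallPoints_natFloor d ht.1]
    exact sum_l1BallPoints_natCast_le floor_sq_le hg fun j hj =>
      hF j (hj.trans ((Nat.le_self_pow two_ne_zero _).trans floor_sq_le)) x
  · rw [norm_smul, Real.norm_ofNat]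
    linarith

end Domination

section Transfer

open Finset
open scoped lp

theorem exists_lp_eq_norm_rpow_div {α : Type*} {E : α → Type*} [∀ x, NormedAddCommGroup (E x)]
    {p q : ℝ≥0∞} (hp : 0 < p.toReal) (hq : 0 < q.toReal) (f : lp E p) :
    ∃ g : lp (fun _ : α => ℝ) q, (∀ x, g x = ‖f x‖ ^ (p.toReal / q.toReal)) ∧
      ‖g‖ = ‖f‖ ^ (p.toReal / q.toReal) := by
  have rpow_eq : ∀ x, ‖‖f x‖ ^ (p.toReal / q.toReal)‖ ^ q.toReal = ‖f x‖ ^ p.toReal := fun x => by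
    rw [Real.norm_of_nonneg (by positivity), ← Real.rpow_mul (norm_nonneg _),
      div_mul_cancel₀ _ hq.ne']
  refine ⟨⟨fun x => ‖f x‖ ^ (p.toReal / q.toReal), memℓp_gen ?_⟩, fun _ => rfl, ?_⟩
  · simpa only [rpow_eq] using (lp.memℓp f).summable hp
  · rw [lp.norm_eq_tsum_rpow hq, tsum_congr rpow_eq, ← lp.norm_rpow_eq_tsum hp,
      ← Real.rpow_mul (lp.norm_nonneg' f), mul_one_div]

theorem norm_l1Average_rpow_le {d : ℕ} {t q : ℝ} (ht : 0 ≤ t) (hq : 1 ≤ q)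
    (f : (Fin d → ℤ) → ℂ) (x : Fin d → ℤ) :
    ‖l1Average d t f x‖ ^ q ≤
      ∑ y ∈ l1BallPoints d t, (#(l1BallPoints d t) : ℝ)⁻¹ * ‖f (x - y)‖ ^ q := by
  have hcard : (#(l1BallPoints d t) : ℝ) ≠ 0 := by
    exact_mod_cast card_ne_zero_of_mem (zero_mem_l1BallPoints d ht)
  calc ‖l1Average d t f x‖ ^ q
      ≤ (∑ y ∈ l1BallPoints d t, (#(l1BallPoints d t) : ℝ)⁻¹ * ‖f (x - y)‖) ^ q := by
        rw [l1Average, norm_mul, norm_inv, Complex.norm_natCast, ← mul_sum]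
        gcongr
        exact norm_sum_le _ _
    _ ≤ ∑ y ∈ l1BallPoints d t, (#(l1BallPoints d t) : ℝ)⁻¹ * ‖f (x - y)‖ ^ q := by
        refine Real.rpow_arith_mean_le_arith_mean_rpow _ _ _ (fun _ _ => by positivity) ?_
          (fun _ _ => norm_nonneg _) hq
        rw [sum_const, nsmul_eq_mul, mul_inv_cancel₀ hcard]

theorem exists_norm_l1Average_le_norm_le {p : ℝ} (hp : 2 ≤ p) {d : ℕ}
    (f : lp (fun _ : Fin d → ℤ => ℂ) (ENNReal.ofReal p)) :
    ∃ G : lp (fun _ : Fin d → ℤ => ℝ) (ENNReal.ofReal p),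
      (∀ t ∈ Set.Icc 0 √(d : ℝ), ∀ x, ‖l1Average d t (fun x => f x) x‖ ≤ G x) ∧
      ‖G‖ ≤ 96 ^ (2 / p) * ‖f‖ := by
  have hp₀ : 0 < p := by linarith
  have toReal_p : (ENNReal.ofReal p).toReal = p := ENNReal.toReal_ofReal hp₀.le
  obtain ⟨g, hg, hgf⟩ := exists_lp_eq_norm_rpow_div (q := 2) (by rwa [toReal_p]) (by norm_num) f
  obtain ⟨F, hF, hFg⟩ := exists_sum_l1BallPoints_le_norm_le (g := g) fun x => by
    rw [hg]; positivity
  obtain ⟨G, hG, hGF⟩ := exists_lp_eq_norm_rpow_div (p := 2) (q := ENNReal.ofReal p) (by norm_num)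
    (by rwa [toReal_p]) F
  rw [toReal_p, ENNReal.toReal_ofNat] at hgf hGF
  simp only [toReal_p, ENNReal.toReal_ofNat] at hg hG
  refine ⟨G, fun t ht x => ?_, ?_⟩
  · rw [hG, ← inv_div, Real.le_rpow_inv_iff_of_pos (norm_nonneg _) (norm_nonneg _) (by positivity)]
    calc ‖l1Average d t (fun x => f x) x‖ ^ (p / 2)
        ≤ ∑ y ∈ l1BallPoints d t, (#(l1BallPoints d t) : ℝ)⁻¹ * ‖f (x - y)‖ ^ (p / 2) :=
          norm_l1Average_rpow_le ht.1 (by linarith) _ x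
      _ ≤ F x := by simpa only [hg] using hF t ht x
      _ ≤ ‖F x‖ := Real.le_norm_self _
  · calc ‖G‖ = ‖F‖ ^ (2 / p) := hGF
      _ ≤ (96 * ‖f‖ ^ (p / 2)) ^ (2 / p) := by rw [← hgf]; gcongr
      _ = 96 ^ (2 / p) * ‖f‖ := by
        rw [Real.mul_rpow (by norm_num) (Real.rpow_nonneg (lp.norm_nonneg' f) _),
          ← Real.rpow_mul (lp.norm_nonneg' f), div_mul_div_cancel₀ (by norm_num), div_self hp₀.ne',
          Real.rpow_one]

theorem ninety_six_rpow_le_thirty_rpow {p : ℝ} (hp : 0 ≤ p) :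
    (96 : ℝ) ^ (2 / p) ≤ 30 ^ (4 / p) :=
  calc (96 : ℝ) ^ (2 / p) ≤ (30 ^ (2 : ℝ)) ^ (2 / p) := by gcongr; norm_num
    _ = 30 ^ (4 / p) := by rw [← Real.rpow_mul (by norm_num)]; ring_nf

end Transfer

theorem theorem1p1_general (p : ℝ) (hp : 2 ≤ p) (d : ℕ) {ι : Type*} (t : ι → ℝ)
    (ht : ∀ i, t i ∈ Set.Icc 0 √(d : ℝ))
    (f : lp (fun _ : Fin d → ℤ => ℂ) (ENNReal.ofReal p)) :
    ∃ h : Memℓp (fun x => ⨆ i, ‖l1Average d (t i) (fun x => f x) x‖) (ENNReal.ofReal p),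
      ‖(⟨fun x => ⨆ i, ‖l1Average d (t i) (fun x => f x) x‖, h⟩ :
          lp (fun _ : Fin d → ℤ => ℝ) (ENNReal.ofReal p))‖
        ≤ 96 ^ (2 / p) * ‖f‖ := by
  obtain ⟨G, hG, hGf⟩ := exists_norm_l1Average_le_norm_le hp f
  have norm_iSup_le : ∀ x, ‖⨆ i, ‖l1Average d (t i) (fun x => f x) x‖‖ ≤ ‖G x‖ := fun x => by
    rw [Real.norm_of_nonneg (Real.iSup_nonneg fun _ => norm_nonneg _)]
    exact Real.iSup_le (fun i => (hG _ (ht i) x).trans (Real.le_norm_self _)) (norm_nonneg _)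
  exact ⟨(lp.memℓp G).mono' norm_iSup_le,
    (lp.norm_mono (ENNReal.ofReal_pos.2 (by linarith)).ne' norm_iSup_le).trans hGf⟩

theorem theorem1p1 (p : ℝ) (hp : 2 ≤ p) (d : ℕ) (hd : 4 ≤ d)
    (f : lp (fun _ : Fin d → ℤ => ℂ) (ENNReal.ofReal p)) :
    ∃ h : Memℓp (smallDyadicMaximal d (fun x => f x)) (ENNReal.ofReal p),
      ‖(⟨smallDyadicMaximal d (fun x => f x), h⟩ :
          lp (fun _ : Fin d → ℤ => ℝ) (ENNReal.ofReal p))‖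
        ≤ (30 : ℝ) ^ (4 / p) * ‖f‖ := by
  obtain ⟨h, hle⟩ := theorem1p1_general p hp d
    (fun t : {t : ℝ // t ∈ dyadicIntegers ∧ t ≤ √(d : ℝ)} => t)
    (by rintro ⟨_, ⟨n, rfl⟩, hn⟩; exact ⟨by positivity, hn⟩) f
  exact ⟨h, hle.trans (mul_le_mul_of_nonneg_right (ninety_six_rpow_le_thirty_rpow (by linarith))
    (lp.norm_nonneg' f))⟩
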